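/- Call a group $G$ \emph{capable} if there is a group $K$ with $G\cong K/Z(K)$, and, for a prime $p$, call a finite group an \emph{extra-special} $p$-group if its center has order $p$ and its central quotient is a nontrivial elementary abelian $p$-group. Let $p$ be an odd prime and let $G$ be a group of nilpotency class two and exponent $p$. Assume that $G^{\mathrm{ab}}=G/[G,G]$ has rank $4$ and that $[G,G]$ has rank $1$ (the rank of a finitely generated group being its minimal number of generators, so that $|G^{\mathrm{ab}}|=p^4$ and $|[G,G]|=p$). Then $G$ is capable if and only if $Z(G)/[G,G]$ is nontrivial; that is, $G$ is capable if and only if $G$ is not an extra-special $p$-group. -/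

import Mathlib

universe u

/-- A group is capable if it is isomorphic to the central quotient `K / Z(K)` of some group `K`.
Taking `K` in the universe of `G` loses nothing: if `K / Z(K)` is isomorphic to `G`, then a
subgroup of `K` generated by lifts of the elements of `G` has the same central quotient. -/
def IsCapable (G : Type u) [Group G] : Prop :=
  ∃ (K : Type u) (_ : Group K), Nonempty (G ≃* K ⧸ Subgroup.center K)

/-- A finite group is an extra-special `p`-group if its center has order `p` and its central
quotient is a nontrivial elementary abelian `p`-group. -/
structure IsExtraSpecial (p : ℕ) (G : Type u) [Group G] : Prop where
  finite : Finite G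
  card_center : Nat.card (Subgroup.center G) = p
  nontrivial_quotient : Nontrivial (G ⧸ Subgroup.center G)
  comm_quotient : ∀ x y : G ⧸ Subgroup.center G, x * y = y * x
  pow_quotient : ∀ x : G ⧸ Subgroup.center G, x ^ p = 1

/-!
If `G ≅ K / Z(K)` and `k : K` lies over an element of `⁅C(x), C(x)⁆`, the three subgroups lemma
shows that `k` commutes with every lift of `x`; so in a capable group the subgroups `⁅C(x), C(x)⁆`
have trivial intersection. When `⁅G, G⁆` has prime order `p` this forces some noncentral `x` to have
an abelian centralizer. Conversely, in exponent `p`, an abelian normal subgroup of index `p` gives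
an explicit cover of `G`. Since `g ↦ ⁅g, x⁆` is a homomorphism onto `⁅G, G⁆` for noncentral `x`, the
centralizer `C(x)` has index `p`. If it is abelian then `|G / Z(G)| = p ^ 2`, and it is abelian as
soon as `|G / Z(G)|` divides `p ^ 3`. Hence `G` is capable iff `|G / Z(G)| = p ^ 2`. As `|G / Z(G)|`
divides `|G / ⁅G, G⁆| = p ^ 4` and is neither `1`, `p` nor `p ^ 3`, the alternative is
`Z(G) = ⁅G, G⁆`.
-/

open Subgroup
open scoped commutatorElement IsMulCommutative

theorem isCapable_iff_exists_surjective {G : Type u} [Group G] :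
    IsCapable G ↔ ∃ (K : Type u) (_ : Group K) (f : K →* G),
      Function.Surjective f ∧ f.ker = center K := by
  constructor
  · rintro ⟨K, _, ⟨e⟩⟩
    refine ⟨K, _, e.symm.toMonoidHom.comp (QuotientGroup.mk' (center K)),
      e.symm.surjective.comp (QuotientGroup.mk'_surjective _), ?_⟩
    exact (MonoidHom.ker_mulEquiv_comp _ e.symm).trans (QuotientGroup.ker_mk' _)
  · rintro ⟨K, _, f, hf, hker⟩
    exact ⟨K, _, ⟨(QuotientGroup.quotientKerEquivOfSurjective f hf).symm.trans
      (QuotientGroup.quotientMulEquivOfEq hker)⟩⟩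

section NotCapable

theorem commutator_comap_centralizer_le_centralizer {K G : Type*} [Group K] [Group G]
    {f : K →* G} (hker : f.ker ≤ center K) (t : K) :
    ⁅(centralizer {f t}).comap f, (centralizer {f t}).comap f⁆ ≤ centralizer {t} := by
  set D := (centralizer {f t}).comap f
  have hD : ⁅D, zpowers t⁆ ≤ center K := by
    refine le_trans ?_ hker
    rw [commutator_le]
    rintro d hd _ ⟨n, rfl⟩
    have hdt : Commute (f d) (f t) := mem_centralizer_singleton_iff.1 hd
    rw [MonoidHom.mem_ker, map_commutatorElement, map_zpow]
    exact commutatorElement_eq_one_iff_commute.2 (hdt.zpow_right n)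
  have hDD : ⁅⁅D, zpowers t⁆, D⁆ = ⊥ :=
    commutator_eq_bot_iff_le_centralizer.2 (hD.trans (center_le_centralizer _))
  have hrotate : ⁅⁅D, D⁆, zpowers t⁆ = ⊥ :=
    commutator_commutator_eq_bot_of_rotate hDD (by rwa [commutator_comm (zpowers t)])
  refine (commutator_eq_bot_iff_le_centralizer.1 hrotate).trans (centralizer_le ?_)
  exact Set.singleton_subset_iff.2 (mem_zpowers t)

theorem IsCapable.iInf_commutator_centralizer_eq_bot {G : Type u} [Group G] (hG : IsCapable G) :
    ⨅ x : G, ⁅centralizer {x}, centralizer {x}⁆ = ⊥ := by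
  obtain ⟨K, _, f, hf, hker⟩ := isCapable_iff_exists_surjective.1 hG
  refine (eq_bot_iff_forall _).2 fun n hn => ?_
  obtain ⟨k, rfl⟩ := hf n
  rw [← MonoidHom.mem_ker, hker, mem_center_iff]
  intro t
  have hkt : f k ∈ ⁅centralizer {f t}, centralizer {f t}⁆ := mem_iInf.1 hn (f t)
  rw [← map_comap_eq_self_of_surjective hf (centralizer {f t}), ← map_commutator] at hkt
  obtain ⟨d, hd, hdk⟩ := hkt
  have hdt : Commute t d :=
    (mem_centralizer_singleton_iff.1
      (commutator_comap_centralizer_le_centralizer hker.le t hd)).symm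
  have hz : d⁻¹ * k ∈ center K := by
    rw [← hker, MonoidHom.mem_ker, map_mul, map_inv, hdk, inv_mul_cancel]
  have htk : Commute t (d * (d⁻¹ * k)) := hdt.mul_right (mem_center_iff.1 hz t)
  rwa [mul_inv_cancel_left] at htk

theorem IsCapable.exists_isMulCommutative_centralizer {G : Type u} [Group G] (hG : IsCapable G)
    (hcard : (Nat.card (commutator G)).Prime) :
    ∃ x ∉ center G, IsMulCommutative (centralizer {x}) := by
  by_contra! hnoncomm
  have : Fact (Nat.card (commutator G)).Prime := ⟨hcard⟩
  have hcomm (x : G) : ⁅centralizer {x}, centralizer {x}⁆ = commutator G := by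
    by_cases hx : x ∈ center G
    · rw [centralizer_eq_top_iff_subset.2 (Set.singleton_subset_iff.2 hx), commutator_def]
    have hle : ⁅centralizer {x}, centralizer {x}⁆ ≤ commutator G := commutator_mono le_top le_top
    refine hle.antisymm (subgroupOf_eq_top.1 ?_)
    refine (eq_bot_or_eq_top_of_prime_card _).resolve_left fun hbot => hnoncomm x hx ?_
    rw [subgroupOf_eq_bot, disjoint_of_le_iff_left_eq_bot hle] at hbot
    exact le_centralizer_iff_isMulCommutative.1 (commutator_eq_bot_iff_le_centralizer.1 hbot)
  refine hcard.ne_one ?_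
  rw [card_eq_one, ← hG.iInf_commutator_centralizer_eq_bot, iInf_congr hcomm, iInf_const]

end NotCapable

section Cover

/-- The automorphism `(a, b) ↦ (T a, b a)` of `A × A`. It lifts `T` along the first projection and,
whatever `T` is, fixes exactly `1 × A`; this is what makes the cover of `shearCoverHom` central. -/
def shear {A : Type*} [CommGroup A] (T : MulAut A) : MulAut (A × A) where
  toFun a := (T a.1, a.2 * a.1)
  invFun a := (T⁻¹ a.1, a.2 * (T⁻¹ a.1)⁻¹)
  left_inv a := by simp
  right_inv a := by simp
  map_mul' a b := by simp [mul_mul_mul_comm]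

section Shear

variable {A : Type*} [CommGroup A] (T : MulAut A)

theorem shear_apply (a : A × A) : shear T a = (T a.1, a.2 * a.1) := rfl

theorem shear_apply_eq_self_iff {a : A × A} : shear T a = a ↔ a.1 = 1 := by
  rw [shear_apply, Prod.ext_iff, mul_eq_left, and_iff_right_iff_imp]
  intro h
  rw [h, map_one]

theorem shear_ne_one [Nontrivial A] : shear T ≠ 1 := fun h => by
  obtain ⟨a, ha⟩ := exists_ne (1 : A)
  exact ha ((shear_apply_eq_self_iff T).1 (DFunLike.congr_fun h (a, 1)))

theorem shear_zpow_apply_fst (k : ℤ) (a : A × A) : ((shear T ^ k) a).1 = (T ^ k) a.1 := by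
  induction k generalizing a with
  | zero => simp
  | succ k ih => rw [zpow_add_one, zpow_add_one, MulAut.mul_apply, ih]; rfl
  | pred k ih => rw [zpow_sub_one, zpow_sub_one, MulAut.mul_apply, ih]; rfl

end Shear

theorem mem_center_semidirectProduct_iff {A H : Type*} [CommGroup A] [CommGroup H]
    {φ : H →* MulAut A} {z : A ⋊[φ] H} :
    z ∈ center (A ⋊[φ] H) ↔ φ z.right = 1 ∧ ∀ h, φ h z.left = z.left := by
  simp only [mem_center_iff, SemidirectProduct.ext_iff, SemidirectProduct.mul_left,
    SemidirectProduct.mul_right]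
  constructor
  · refine fun hz => ⟨MulEquiv.ext fun a => ?_, fun h => ?_⟩
    · simpa [mul_comm a] using (hz (.inl a)).1.symm
    · simpa using (hz (.inr h)).1
  · rintro ⟨hright, hleft⟩ g
    simp [hright, hleft, mul_comm]

variable {G : Type u} [Group G]

theorem shear_conjNormal_pow_apply_snd {N : Subgroup G} [N.Normal] [IsMulCommutative N]
    (x : G) (k : ℕ) (n : N × N) :
    (((shear (MulAut.conjNormal x) ^ k) n).2 : G) = n.2 * ((n.1 * x) ^ k * (x ^ k)⁻¹) := by
  induction k with
  | zero => simp
  | succ k ih =>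
    have hfst := shear_zpow_apply_fst (MulAut.conjNormal x : MulAut N) k n
    rw [← map_zpow, zpow_natCast, zpow_natCast] at hfst
    rw [pow_succ', MulAut.mul_apply, shear_apply, coe_mul, ih, hfst, MulAut.conjNormal_apply,
      pow_succ (_ * x), pow_succ x]
    group

theorem shear_conjNormal_pow_eq_one {N : Subgroup G} [N.Normal] [IsMulCommutative N] {p : ℕ}
    (hexp : ∀ g : G, g ^ p = 1) (x : G) :
    shear (MulAut.conjNormal x : MulAut N) ^ p = 1 := by
  ext n
  · have := shear_zpow_apply_fst (MulAut.conjNormal x : MulAut N) p n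
    rw [zpow_natCast, zpow_natCast, ← map_pow, hexp, map_one] at this
    exact congrArg Subtype.val this
  · rw [shear_conjNormal_pow_apply_snd, hexp, hexp, inv_one, mul_one, mul_one, MulAut.one_apply]

/-- The homomorphism `((a, b), k) ↦ a x ^ k` from `(N × N) ⋊ ℤ` to `G`, where `1 : ℤ` acts on
`N × N` by the shear of conjugation by `x`. When `⟨x⟩` is a complement of `N` and the shear has the
order of `x`, its kernel is the center, which exhibits `G` as capable. -/
def shearCoverHom (N : Subgroup G) [N.Normal] [IsMulCommutative N] (x : G) :
    (N × N) ⋊[zpowersHom (MulAut (N × N)) (shear (MulAut.conjNormal x))] Multiplicative ℤ →* G :=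
  SemidirectProduct.lift (N.subtype.comp (MonoidHom.fst N N)) (zpowersHom G x) fun k => by
    ext n
    simp [shear_zpow_apply_fst, ← map_zpow]

theorem shearCoverHom_apply (N : Subgroup G) [N.Normal] [IsMulCommutative N] (x : G)
    (k : (N × N) ⋊[zpowersHom (MulAut (N × N)) (shear (MulAut.conjNormal x))] Multiplicative ℤ) :
    shearCoverHom N x k = k.left.1 * x ^ k.right.toAdd := rfl

theorem isCapable_of_isCompl_zpowers {N : Subgroup G} [N.Normal] [IsMulCommutative N] {x : G}
    (hcompl : IsCompl N (zpowers x))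
    (horder : orderOf (shear (MulAut.conjNormal x : MulAut N)) = orderOf x) : IsCapable G := by
  refine isCapable_iff_exists_surjective.2 ⟨_, _, shearCoverHom N x, fun g => ?_, ?_⟩
  · obtain ⟨n, hn, _, ⟨k, rfl⟩, rfl⟩ :=
      mem_sup_of_normal_left.1 (hcompl.sup_eq_top ▸ mem_top g : g ∈ N ⊔ zpowers x)
    exact ⟨⟨(⟨n, hn⟩, 1), Multiplicative.ofAdd k⟩, rfl⟩
  · ext k
    have hker : (k.left.1 : G) * x ^ k.right.toAdd = 1 ↔ k.left.1 = 1 ∧ x ^ k.right.toAdd = 1 := by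
      refine ⟨fun h => ?_, fun ⟨hn, hx⟩ => by rw [hn, hx, coe_one, mul_one]⟩
      simpa using disjoint_iff_mul_eq_one.1 hcompl.disjoint k.left.1.2
        (zpow_mem (mem_zpowers x) _) h
    have hfixed : (∀ h, zpowersHom _ (shear (MulAut.conjNormal x)) h k.left = k.left) ↔
        k.left.1 = 1 := by
      rw [← shear_apply_eq_self_iff (MulAut.conjNormal x : MulAut N)]
      exact ⟨fun h => by simpa using h (.ofAdd 1), fun h m =>
        zpow_mem (K := MulAction.stabilizer (MulAut (N × N)) k.left) h m.toAdd⟩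
    rw [MonoidHom.mem_ker, shearCoverHom_apply, hker, mem_center_semidirectProduct_iff, hfixed,
      zpowersHom_apply, ← orderOf_dvd_iff_zpow_eq_one, ← orderOf_dvd_iff_zpow_eq_one, horder,
      and_comm]

theorem isCompl_zpowers_of_prime_index {N : Subgroup G} [N.Normal]
    {p : ℕ} [Fact p.Prime] (hN : N.index = p) {x : G} (hx : x ∉ N) (hxp : x ^ p = 1) :
    IsCompl N (zpowers x) := by
  have hne : (x : G ⧸ N) ≠ 1 := fun h => hx ((QuotientGroup.eq_one_iff x).1 h)
  have hxq : (x : G ⧸ N) ^ p = 1 := by rw [← QuotientGroup.mk_pow, hxp, QuotientGroup.mk_one]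
  have hord : orderOf (x : G ⧸ N) = orderOf x := by
    rw [orderOf_eq_prime hxq hne, orderOf_eq_prime hxp fun h => hx (h ▸ one_mem N)]
  constructor
  · rw [disjoint_def]
    rintro _ hmem ⟨k, rfl⟩
    rw [← orderOf_dvd_iff_zpow_eq_one, ← hord, orderOf_dvd_iff_zpow_eq_one, ← QuotientGroup.mk_zpow,
      QuotientGroup.eq_one_iff]
    exact hmem
  · rw [codisjoint_iff_le_sup]
    intro g _
    obtain ⟨k, hk⟩ := mem_zpowers_iff.1 (mem_zpowers_of_prime_card hN hne (g' := (g : G ⧸ N)))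
    have hn : g * (x ^ k)⁻¹ ∈ N := by
      rw [← QuotientGroup.eq_one_iff, QuotientGroup.mk_mul, QuotientGroup.mk_inv,
        QuotientGroup.mk_zpow, hk, mul_inv_cancel]
    simpa using mul_mem_sup hn (zpow_mem (mem_zpowers x) k)

theorem isCapable_of_prime_index {N : Subgroup G} [N.Normal] [IsMulCommutative N] {p : ℕ}
    [Fact p.Prime] (hexp : ∀ g : G, g ^ p = 1) (hindex : N.index = p) (hN : N ≠ ⊥) :
    IsCapable G := by
  have := (nontrivial_iff_ne_bot N).2 hN
  obtain ⟨x, hx⟩ : ∃ x, x ∉ N := by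
    by_contra! h
    rw [(eq_top_iff' N).2 h, index_top] at hindex
    exact (Fact.out : p.Prime).one_lt.ne hindex
  refine isCapable_of_isCompl_zpowers (isCompl_zpowers_of_prime_index hindex hx (hexp x)) ?_
  rw [orderOf_eq_prime (shear_conjNormal_pow_eq_one hexp x) (shear_ne_one _),
    orderOf_eq_prime (hexp x) fun h => hx (h ▸ one_mem N)]

end Cover

section Centralizers

variable {G : Type u} [Group G]

/-- In a group whose derived subgroup is central, commutation with a fixed element is a
homomorphism. -/
def commutatorHom (hle : commutator G ≤ center G) (y : G) : G →* G where
  toFun g := ⁅g, y⁆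
  map_one' := commutatorElement_one_left y
  map_mul' a b := by
    have hb : ⁅b, y⁆ ∈ center G := hle (commutator_mem_commutator (mem_top b) (mem_top y))
    rw [commutatorElement_mul_left_eq_conj_mul, mem_center_iff.1 hb a, mul_inv_cancel_right,
      mem_center_iff.1 hb]

theorem ker_commutatorHom (hle : commutator G ≤ center G) (y : G) :
    (commutatorHom hle y).ker = centralizer {y} := by
  ext g
  rw [mem_centralizer_singleton_iff]
  exact MonoidHom.mem_ker.trans commutatorElement_eq_one_iff_mul_comm

theorem index_centralizer_dvd_card_commutator (hle : commutator G ≤ center G) (y : G) :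
    (centralizer {y}).index ∣ Nat.card (commutator G) := by
  rw [← ker_commutatorHom hle, index_ker]
  refine card_dvd_of_le ?_
  rintro _ ⟨g, rfl⟩
  exact commutator_mem_commutator (mem_top g) (mem_top y)

variable {p : ℕ}

theorem index_centralizer_eq (hp : p.Prime) (hle : commutator G ≤ center G)
    (hcard : Nat.card (commutator G) = p) {x : G} (hx : x ∉ center G) :
    (centralizer {x}).index = p := by
  refine (hp.eq_one_or_self_of_dvd _ (hcard ▸ index_centralizer_dvd_card_commutator hle x)
    ).resolve_left fun h => hx ?_
  rwa [index_eq_one, centralizer_eq_top_iff_subset, Set.singleton_subset_iff] at h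

theorem centralizer_eq_of_le (hp : p.Prime) (hle : commutator G ≤ center G)
    (hcard : Nat.card (commutator G) = p) {x a : G} (hx : x ∉ center G) (ha : a ∉ center G)
    (hxa : centralizer {x} ≤ centralizer {a}) : centralizer {x} = centralizer {a} := by
  refine le_antisymm hxa (relIndex_eq_one.1 ?_)
  have hmul := relIndex_mul_index hxa
  rw [index_centralizer_eq hp hle hcard hx, index_centralizer_eq hp hle hcard ha] at hmul
  exact Nat.eq_of_mul_eq_mul_right hp.pos (hmul.trans (one_mul p).symm)

theorem index_center_eq_sq_of_isMulCommutative_centralizer (hp : p.Prime)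
    (hle : commutator G ≤ center G) (hcard : Nat.card (commutator G) = p) {x : G}
    (hx : x ∉ center G) [IsMulCommutative (centralizer {x})] : (center G).index = p ^ 2 := by
  have hxindex := index_centralizer_eq hp hle hcard hx
  obtain ⟨g, hg⟩ : ∃ g, g ∉ centralizer {x} := by
    by_contra! h
    rw [(eq_top_iff' _).2 h, index_top] at hxindex
    exact hp.one_lt.ne hxindex
  have hinf : centralizer {g} ⊓ centralizer {x} ≤ center G := by
    rintro a ⟨hag, hax⟩
    by_contra ha
    have hxa : centralizer {x} ≤ centralizer {a} :=
      (le_centralizer (centralizer {x})).trans (centralizer_le (Set.singleton_subset_iff.2 hax))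
    refine hg (centralizer_eq_of_le hp hle hcard hx ha hxa ▸ ?_)
    exact mem_centralizer_singleton_iff.2 (mem_centralizer_singleton_iff.1 hag).symm
  have : (centralizer {g}).Normal := .of_commutator_le G (hle.trans (center_le_centralizer _))
  have hdvd : (center G).relIndex (centralizer {x}) ∣ p := by
    rw [← hcard]
    refine (relIndex_dvd_of_le_left _ hinf).trans ?_
    rw [inf_relIndex_right]
    exact (relIndex_dvd_index_of_normal _ _).trans (index_centralizer_dvd_card_commutator hle g)
  have hne : (center G).relIndex (centralizer {x}) ≠ 1 := fun h =>
    hx (relIndex_eq_one.1 h (mem_centralizer_singleton_iff.2 rfl))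
  rw [← relIndex_mul_index (center_le_centralizer {x}), hxindex,
    (hp.eq_one_or_self_of_dvd _ hdvd).resolve_left hne, sq]

theorem isMulCommutative_centralizer_of_index_center_dvd (hp : p.Prime)
    (hle : commutator G ≤ center G) (hcard : Nat.card (commutator G) = p)
    (hindex : (center G).index ∣ p ^ 3) {x : G} (hx : x ∉ center G) :
    IsMulCommutative (centralizer {x}) := by
  set C := centralizer {x} with hC
  have hindexC : C.index = p := index_centralizer_eq hp hle hcard hx
  have hZ : (center G).subgroupOf C ≤ center C := fun z hz =>
    mem_center_iff.2 fun c => Subtype.ext (mem_center_iff.1 hz c)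
  have hmul : ((center G).subgroupOf C).relIndex (center C) * (center C).index ∣ p ^ 2 := by
    have hZC := relIndex_mul_index (center_le_centralizer {x})
    rw [relIndex_mul_index hZ]
    rw [← hZC, ← hC, hindexC, pow_succ] at hindex
    exact Nat.dvd_of_mul_dvd_mul_right hp.pos hindex
  have hne : ((center G).subgroupOf C).relIndex (center C) ≠ 1 := fun h => by
    have hxC : (⟨x, mem_centralizer_singleton_iff.2 rfl⟩ : C) ∈ center C :=
      mem_center_iff.2 fun c => Subtype.ext (mem_centralizer_singleton_iff.1 c.2)
    exact hx (relIndex_eq_one.1 h hxC)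
  obtain ⟨k, -, hpow⟩ := (Nat.dvd_prime_pow hp).1 ((dvd_mul_right _ _).trans hmul)
  have hdvd : (center C).index ∣ p := by
    refine Nat.dvd_of_mul_dvd_mul_left hp.pos (dvd_trans (mul_dvd_mul_right ?_ _) (sq p ▸ hmul))
    rw [hpow]
    exact dvd_pow_self p fun hk => hne (by rw [hpow, hk, pow_zero])
  have : Fact p.Prime := ⟨hp⟩
  have : IsCyclic (C ⧸ center C) := isCyclic_of_card_dvd_prime hdvd
  exact isMulCommutative_of_isCyclic_quotient_center_self C

theorem exists_notMem_center (hcard : Nat.card (commutator G) ≠ 1) : ∃ x, x ∉ center G := by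
  by_contra! h
  exact hcard (card_eq_one.2 (commutator_top_right_eq_bot_iff_le_center.2 fun x _ => h x))

theorem index_center_eq_sq_of_dvd (hp : p.Prime) (hle : commutator G ≤ center G)
    (hcard : Nat.card (commutator G) = p) (hindex : (center G).index ∣ p ^ 3) :
    (center G).index = p ^ 2 := by
  obtain ⟨x, hx⟩ := exists_notMem_center (hcard ▸ hp.ne_one)
  have := isMulCommutative_centralizer_of_index_center_dvd hp hle hcard hindex hx
  exact index_center_eq_sq_of_isMulCommutative_centralizer hp hle hcard hx

theorem isCapable_iff_index_center_eq_sq (hp : p.Prime) (hexp : ∀ g : G, g ^ p = 1)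
    (hle : commutator G ≤ center G) (hcard : Nat.card (commutator G) = p) :
    IsCapable G ↔ (center G).index = p ^ 2 := by
  constructor
  · intro hG
    obtain ⟨x, hx, _⟩ := hG.exists_isMulCommutative_centralizer (hcard ▸ hp)
    exact index_center_eq_sq_of_isMulCommutative_centralizer hp hle hcard hx
  · intro hindex
    obtain ⟨x, hx⟩ := exists_notMem_center (hcard ▸ hp.ne_one)
    have := isMulCommutative_centralizer_of_index_center_dvd hp hle hcard
      (hindex ▸ pow_dvd_pow p (by lia)) hx
    have : (centralizer {x}).Normal := .of_commutator_le G (hle.trans (center_le_centralizer _))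
    have : Fact p.Prime := ⟨hp⟩
    refine isCapable_of_prime_index hexp (index_centralizer_eq hp hle hcard hx) fun h => hx ?_
    have hxC : x ∈ centralizer {x} := mem_centralizer_singleton_iff.2 rfl
    rw [h, mem_bot] at hxC
    exact hxC ▸ one_mem _

end Centralizers

section ElementaryAbelian

theorem rank_le_finrank {A : Type*} [CommGroup A] [Group.FG A] {p : ℕ} [Fact p.Prime]
    [Module (ZMod p) (Additive A)] [Module.Finite (ZMod p) (Additive A)] :
    Group.rank A ≤ Module.finrank (ZMod p) (Additive A) := by
  classical
  let b := Module.finBasis (ZMod p) (Additive A)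
  let S : Finset A := Finset.univ.image fun i => (b i).toMul
  have hspan : Submodule.span (ZMod p) (Set.range b) ≤
      AddSubgroup.toZModSubmodule p (toAddSubgroup (closure (S : Set A))) := by
    rw [Submodule.span_le]
    rintro _ ⟨i, rfl⟩
    change (b i).toMul ∈ closure (S : Set A)
    exact subset_closure (Finset.mem_coe.2 (Finset.mem_image_of_mem _ (Finset.mem_univ i)))
  have hS : closure (S : Set A) = ⊤ :=
    eq_top_iff.2 fun x _ => hspan (x := Additive.ofMul x) (b.mem_span _)
  simpa using (Group.rank_le hS).trans Finset.card_image_le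

theorem card_eq_pow_rank {A : Type*} [CommGroup A] [Group.FG A] {p : ℕ}
    (hp : p.Prime) (hpow : ∀ a : A, a ^ p = 1) : Nat.card A = p ^ Group.rank A := by
  have : Fact p.Prime := ⟨hp⟩
  have hdvd : Nat.card A ∣ p ^ Group.rank A := card_dvd_exponent_pow_rank' A hpow
  have hpos : 0 < p ^ Group.rank A := pow_pos hp.pos _
  have : Finite A := Nat.finite_of_card_ne_zero (ne_zero_of_dvd_ne_zero hpos.ne' hdvd)
  have : Module (ZMod p) (Additive A) := AddCommGroup.zmodModule fun a => hpow a.toMul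
  have hrank : Group.rank A ≤ Module.finrank (ZMod p) (Additive A) := rank_le_finrank
  refine (Nat.le_of_dvd hpos hdvd).antisymm ?_
  calc p ^ Group.rank A ≤ p ^ Module.finrank (ZMod p) (Additive A) :=
        Nat.pow_le_pow_right hp.pos hrank
    _ = Nat.card A := FiniteField.pow_finrank_eq_natCard p (Additive A)

end ElementaryAbelian

section MainTheorem

theorem commutator_le_center_of_nilpotencyClass_eq_two {G : Type*} [Group G]
    (hclass : Group.nilpotencyClass G = 2) : commutator G ≤ center G := by
  have : Group.IsNilpotent G := by
    by_contra h
    rw [Group.nilpotencyClass_of_not_nilpotent h] at hclass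
    lia
  have hlcs : (⊤ : Subgroup G).lowerCentralSeries 2 = ⊥ :=
    Subgroup.lowerCentralSeries_eq_bot_iff_nilpotencyClass_le.2 hclass.le
  exact commutator_top_right_eq_bot_iff_le_center.1 hlcs

theorem isExtraSpecial_iff_commutator_eq_center {G : Type u} [Group G] [Finite G] {p : ℕ}
    (hp : p ≠ 1) (hexp : ∀ g : G, g ^ p = 1) (hle : commutator G ≤ center G)
    (hcard : Nat.card (commutator G) = p) : IsExtraSpecial p G ↔ commutator G = center G := by
  constructor
  · intro h
    exact eq_of_le_of_card_ge hle (by rw [h.card_center, hcard])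
  · intro h
    obtain ⟨x, hx⟩ := exists_notMem_center (hcard ▸ hp)
    exact {
      finite := ‹_›
      card_center := h ▸ hcard
      nontrivial_quotient := QuotientGroup.nontrivial_iff.2 fun htop => hx (htop ▸ mem_top x)
      comm_quotient := (Normal.quotient_commutative_iff_commutator_le.2 hle).is_comm.comm
      pow_quotient := by
        rintro ⟨g⟩
        exact congrArg QuotientGroup.mk (hexp g) }

theorem nontrivial_center_quotient_commutator_iff {G : Type*} [Group G]
    (hle : commutator G ≤ center G) :
    Nontrivial (center G ⧸ (commutator G).subgroupOf (center G)) ↔ commutator G ≠ center G := by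
  rw [QuotientGroup.nontrivial_iff, Ne, subgroupOf_eq_top, hle.ge_iff_eq]

theorem isCapable_iff_commutator_ne_center {G : Type u} [Group G] {p r : ℕ} (hp : p.Prime)
    (hexp : ∀ g : G, g ^ p = 1) (hle : commutator G ≤ center G)
    (hcard : Nat.card (commutator G) = p) (hindex : (commutator G).index = p ^ r)
    (hr : r ∈ Set.Icc 3 4) : IsCapable G ↔ commutator G ≠ center G := by
  rw [isCapable_iff_index_center_eq_sq hp hexp hle hcard]
  constructor
  · intro hsq heq
    rw [heq, hsq] at hindex
    have h2r : 2 = r := Nat.pow_right_injective hp.two_le hindex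
    grind
  · intro hne
    obtain ⟨k, -, hk⟩ := (Nat.dvd_prime_pow hp).1 (hindex ▸ index_dvd_of_le hle)
    have : (commutator G).FiniteIndex := ⟨hindex ▸ pow_ne_zero r hp.ne_zero⟩
    have hlt := index_strictAnti (hle.lt_of_ne hne)
    rw [hindex, hk, Nat.pow_lt_pow_iff_right hp.one_lt] at hlt
    exact index_center_eq_sq_of_dvd hp hle hcard (hk ▸ pow_dvd_pow p (by grind))

theorem mainTheorem11_general {p : ℕ} (hp : p.Prime) (G : Type u) [Group G]
    (hclass : Group.nilpotencyClass G = 2) (hexp : Monoid.exponent G = p)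
    [Group.FG (Abelianization G)] [Group.FG (commutator G)]
    (hab : Group.rank (Abelianization G) ∈ Set.Icc 3 4)
    (hcomm : Group.rank (commutator G) = 1) :
    (IsCapable G ↔
      Nontrivial (Subgroup.center G ⧸ (commutator G).subgroupOf (Subgroup.center G))) ∧
    (IsCapable G ↔ ¬ IsExtraSpecial p G) := by
  have hle := commutator_le_center_of_nilpotencyClass_eq_two hclass
  have hpow (g : G) : g ^ p = 1 := hexp ▸ Monoid.pow_exponent_eq_one g
  have : IsMulCommutative (commutator G) :=
    le_centralizer_iff_isMulCommutative.1 (hle.trans (center_le_centralizer _))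
  have hcard : Nat.card (commutator G) = p := by
    rw [card_eq_pow_rank hp fun a => Subtype.ext (hpow a), hcomm, pow_one]
  have hindex : (commutator G).index = p ^ Group.rank (Abelianization G) := by
    refine card_eq_pow_rank (A := Abelianization G) hp ?_
    rintro ⟨g⟩
    exact congrArg QuotientGroup.mk (hpow g)
  have : Finite G := Nat.finite_of_card_ne_zero <| by
    rw [← (commutator G).card_mul_index, hcard, hindex]
    exact mul_ne_zero hp.ne_zero (pow_ne_zero _ hp.ne_zero)
  have hcapable := isCapable_iff_commutator_ne_center hp hpow hle hcard hindex hab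
  exact ⟨hcapable.trans (nontrivial_center_quotient_commutator_iff hle).symm, hcapable.trans
    (isExtraSpecial_iff_commutator_eq_center hp.ne_one hpow hle hcard).not.symm⟩

end MainTheorem

theorem mainTheorem11 {p : ℕ} (hp : p.Prime) (hp_odd : Odd p)
    (G : Type u) [Group G]
    (hclass : Group.nilpotencyClass G = 2)
    (hexp : Monoid.exponent G = p)
    [Group.FG (Abelianization G)] [Group.FG (commutator G)]
    (hab : Group.rank (Abelianization G) = 4)
    (hcomm : Group.rank (commutator G) = 1) :
    (IsCapable G ↔
      Nontrivial (Subgroup.center G ⧸ (commutator G).subgroupOf (Subgroup.center G))) ∧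
    (IsCapable G ↔ ¬ IsExtraSpecial p G) :=
  mainTheorem11_general hp G hclass hexp ⟨by lia, hab.le⟩ hcomm
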